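/- Let $\mathbb{K}$ be $\mathbb{R}$ or $\mathbb{C}$, let $l_\infty$ be the Banach space of bounded $\mathbb{K}$-valued sequences with the supremum norm, and let $c_0\subset l_\infty$ be the subspace of sequences converging to $0$. An isomorphism is a linear homeomorphism. A Banach space $X$ over $\mathbb{K}$ has the nontrivial intersection property if $\bigcap_{i=1}^\infty\varphi_i^{-1}(0)\neq\{0\}$ for every countable family $(\varphi_i)$ of continuous linear functionals on $X$. Let $M\subset l_\infty$ be a linear subspace isomorphic to $c_0$. Then there exist closed linear subspaces $N\subset M$ and $H\subset l_\infty$ with $N\subset H$, and an isomorphism $T:l_\infty\to H$ (onto $H$) whose restriction $T|_{c_0}:c_0\to N$ is an isomorphism onto $N$. Moreover, the quotient Banach space $H/N$ has the nontrivial intersection property. -/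

import Mathlib

open Filter Topology

/-- The Banach space `l_∞` of bounded scalar sequences with the supremum norm. -/
abbrev EllInfty (𝕜 : Type*) [RCLike 𝕜] : Type _ := lp (fun _ : ℕ => 𝕜) ⊤

/-- The subspace `c_0` of `l_∞` of the sequences that converge to zero. -/
def cZero (𝕜 : Type*) [RCLike 𝕜] : Submodule 𝕜 (EllInfty 𝕜) where
  carrier := {x | Tendsto (fun n : ℕ => x n) atTop (𝓝 0)}
  zero_mem' := by
    simp
  add_mem' := by
    intro x y hx hy
    simpa using Tendsto.add hx hy
  smul_mem' := by
    intro c x hx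
    simpa using Tendsto.const_mul c hx

/-- The nontrivial intersection property: any countably many continuous linear functionals
have a common zero other than the origin. (A finite or empty family is covered by repeating
functionals or adding zero functionals. Only a seminorm is asked for, so that the definition
applies to a quotient before the subspace is known to be closed.) -/
def HasNIP (𝕜 X : Type*) [RCLike 𝕜] [SeminormedAddCommGroup X] [NormedSpace 𝕜 X] : Prop :=
  ∀ φ : ℕ → StrongDual 𝕜 X, (⋂ i, {x : X | φ i x = 0}) ≠ {0}

/-! Let `J` embed c_0 with image `M`. The values at each coordinate of the images of the unit
vectors are absolutely summable, with sums at most `‖J‖`, so any subsequence of these images defines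
an operator on all of l_∞ by coordinatewise summation. Choosing for each image a coordinate where it
is large gives a row-bounded matrix; Rosenthal's lemma yields a subsequence with small off-diagonal
sums, and diagonal dominance bounds the operator `T` below. Then `H = T(l_∞)` and `N = T(c_0)`. As
H/N corresponds to l_∞/c_0, it remains to treat functionals on l_∞ that vanish on c_0. Each is
nonzero on only countably many indicators of an uncountable almost disjoint family, so some
indicator is killed by all of them. -/

/-- A row-bounded nonnegative matrix indexed by `ℕ` has an infinite square submatrix, indexed by the
range of an injection, whose off-diagonal row sums are small (Rosenthal). -/
theorem exists_injective_offDiag_sum_le {ε : ℝ} (hε : 0 ≤ ε) (K : ℕ) (b : ℕ → ℕ → ℝ)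
    (hb : ∀ n (F : Finset ℕ), ∑ m ∈ F, b n m ≤ K * ε) :
    ∃ f : ℕ → ℕ, Function.Injective f ∧
      ∀ n (F : Finset ℕ), n ∉ F → ∑ m ∈ F, b (f n) (f m) ≤ ε := by
  induction K generalizing b with
  | zero =>
    refine ⟨id, Function.injective_id, fun n F _ => (hb n F).trans ?_⟩
    simpa using hε
  | succ K ih =>
    by_cases h : ∃ p, ∀ n (F : Finset ℕ), n ∉ F →
        ∑ m ∈ F, b (Nat.pair p n) (Nat.pair p m) ≤ ε
    · obtain ⟨p, hp⟩ := h
      exact ⟨fun n => Nat.pair p n, fun m n hmn => (Nat.pair_eq_pair.1 hmn).2, hp⟩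
    · push Not at h
      -- Every column of the pairing now has a bad row `r p`. On the transversal of bad rows, row
      -- `p` loses the mass above `ε` carried by `F p`, which is disjoint from the transversal, so
      -- the bound drops to `K * ε`.
      choose r F hr hF using h
      have hinj : Function.Injective fun p => Nat.pair p (r p) :=
        fun p q hpq => (Nat.pair_eq_pair.1 hpq).1
      obtain ⟨f, hf, hfs⟩ := ih (fun p q => b (Nat.pair p (r p)) (Nat.pair q (r q))) (by
        intro p G
        have hinj' : Function.Injective (Nat.pair p) := fun m n hmn => (Nat.pair_eq_pair.1 hmn).2
        have hdisj : Disjoint (G.image fun q => Nat.pair q (r q)) ((F p).image (Nat.pair p)) := by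
          rw [Finset.disjoint_left]
          intro x hx hx'
          obtain ⟨q, -, rfl⟩ := Finset.mem_image.1 hx
          obtain ⟨m, hm, hmq⟩ := Finset.mem_image.1 hx'
          obtain ⟨rfl, rfl⟩ := Nat.pair_eq_pair.1 hmq
          exact hr _ hm
        have h1 := hb (Nat.pair p (r p))
          ((G.image fun q => Nat.pair q (r q)) ∪ ((F p).image (Nat.pair p)))
        rw [Finset.sum_union hdisj, Finset.sum_image hinj.injOn, Finset.sum_image hinj'.injOn] at h1
        have h2 := hF p
        push_cast at h1
        linarith)
      exact ⟨fun n => Nat.pair (f n) (r (f n)), hinj.comp hf, hfs⟩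

section

variable {𝕜 : Type*} [RCLike 𝕜]

/-- If a functional is bounded by `C` on all combinations with coefficients in the unit ball, then
its values are absolutely summable with sum at most `C`. -/
theorem sum_norm_apply_le {X ι : Type*} [AddCommGroup X] [Module 𝕜 X] (φ : X →ₗ[𝕜] 𝕜) (v : ι → X)
    (F : Finset ι) (C : ℝ)
    (h : ∀ c : ι → 𝕜, (∀ i, ‖c i‖ ≤ 1) → ‖φ (∑ i ∈ F, c i • v i)‖ ≤ C) :
    ∑ i ∈ F, ‖φ (v i)‖ ≤ C := by
  -- Conjugate phases turn each term into its modulus; where the value is zero, division by zero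
  -- gives coefficient zero.
  have h1 := h (fun i => (starRingEnd 𝕜) (φ (v i)) / (‖φ (v i)‖ : 𝕜)) (by
    intro i
    rw [norm_div, RCLike.norm_conj, RCLike.norm_ofReal, abs_norm]
    exact div_self_le_one _)
  have h2 : φ (∑ i ∈ F, ((starRingEnd 𝕜) (φ (v i)) / (‖φ (v i)‖ : 𝕜)) • v i)
      = ((∑ i ∈ F, ‖φ (v i)‖ : ℝ) : 𝕜) := by
    rw [map_sum]
    push_cast
    refine Finset.sum_congr rfl fun i _ => ?_
    rw [map_smul, smul_eq_mul, div_mul_eq_mul_div, RCLike.conj_mul]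
    by_cases h0 : (‖φ (v i)‖ : 𝕜) = 0
    · simp [h0]
    · field_simp
  rw [h2, RCLike.norm_ofReal] at h1
  exact (le_abs_self _).trans h1

/-! ### Coordinates and unit vectors in l_∞ and c_0 -/

theorem EllInfty.norm_apply_le (x : EllInfty 𝕜) (n : ℕ) : ‖x n‖ ≤ ‖x‖ :=
  lp.norm_apply_le_norm ENNReal.top_ne_zero x n

/-- A bounded sequence as an element of `l_∞`. -/
def EllInfty.ofBound (y : ℕ → 𝕜) (C : ℝ) (h : ∀ n, ‖y n‖ ≤ C) : EllInfty 𝕜 :=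
  ⟨y, memℓp_infty ⟨C, by rintro _ ⟨n, rfl⟩; exact h n⟩⟩

@[simp]
theorem EllInfty.ofBound_apply (y : ℕ → 𝕜) (C : ℝ) (h : ∀ n, ‖y n‖ ≤ C) (n : ℕ) :
    EllInfty.ofBound y C h n = y n := rfl

theorem mem_cZero_iff {x : EllInfty 𝕜} : x ∈ cZero 𝕜 ↔ Tendsto (fun n : ℕ => x n) atTop (𝓝 0) :=
  Iff.rfl

theorem isClosed_cZero : IsClosed (cZero 𝕜 : Set (EllInfty 𝕜)) := by
  refine isClosed_of_closure_subset fun x hx => ?_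
  rw [SetLike.mem_coe, mem_cZero_iff, Metric.tendsto_atTop]
  intro ε hε
  obtain ⟨y, hy, hxy⟩ := Metric.mem_closure_iff.1 hx (ε / 2) (half_pos hε)
  obtain ⟨N, hN⟩ := Metric.tendsto_atTop.1 (mem_cZero_iff.1 hy) (ε / 2) (half_pos hε)
  refine ⟨N, fun n hn => ?_⟩
  have h1 := hN n hn
  rw [dist_zero_right] at h1 ⊢
  rw [dist_eq_norm] at hxy
  have h2 : ‖x n - y n‖ ≤ ‖x - y‖ := EllInfty.norm_apply_le (x - y) n
  calc ‖x n‖ = ‖(x n - y n) + y n‖ := by rw [sub_add_cancel]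
    _ ≤ ‖x n - y n‖ + ‖y n‖ := norm_add_le _ _
    _ < ε := by linarith

instance : CompleteSpace (cZero 𝕜) := isClosed_cZero.completeSpace_coe

/-- The unit vectors of `l_∞`. -/
noncomputable def EllInfty.unit (𝕜 : Type*) [RCLike 𝕜] (n : ℕ) : EllInfty 𝕜 := lp.single ⊤ n (1 : 𝕜)

theorem EllInfty.unit_apply (n k : ℕ) : EllInfty.unit 𝕜 n k = if k = n then 1 else 0 := by
  rw [EllInfty.unit, lp.single_apply, Pi.single_apply]

theorem EllInfty.norm_unit (n : ℕ) : ‖EllInfty.unit 𝕜 n‖ = 1 := by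
  rw [EllInfty.unit, lp.norm_single ENNReal.zero_lt_top, norm_one]

theorem EllInfty.unit_mem_cZero (n : ℕ) : EllInfty.unit 𝕜 n ∈ cZero 𝕜 := by
  refine tendsto_const_nhds.congr' ?_
  filter_upwards [eventually_gt_atTop n] with k hk
  rw [EllInfty.unit_apply, if_neg hk.ne']

theorem EllInfty.sum_smul_unit_apply (F : Finset ℕ) (c : ℕ → 𝕜) (k : ℕ) :
    (∑ i ∈ F, c i • EllInfty.unit 𝕜 i) k = if k ∈ F then c k else 0 := by
  rw [lp.coeFn_sum, Finset.sum_apply]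
  simp [EllInfty.unit_apply]

theorem EllInfty.norm_sum_smul_unit_le (F : Finset ℕ) (c : ℕ → 𝕜) (hc : ∀ i, ‖c i‖ ≤ 1) :
    ‖∑ i ∈ F, c i • EllInfty.unit 𝕜 i‖ ≤ 1 := by
  refine lp.norm_le_of_forall_le zero_le_one fun k => ?_
  rw [EllInfty.sum_smul_unit_apply]
  split_ifs
  · exact hc k
  · simp

theorem hasSum_smul_unit {a : EllInfty 𝕜} (ha : a ∈ cZero 𝕜) :
    HasSum (fun n => a n • EllInfty.unit 𝕜 n) a := by
  rw [HasSum, SummationFilter.unconditional_filter, Metric.tendsto_atTop]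
  intro ε hε
  obtain ⟨N, hN⟩ := Metric.tendsto_atTop.1 (mem_cZero_iff.1 ha) (ε / 2) (half_pos hε)
  refine ⟨Finset.range N, fun F hF => ?_⟩
  rw [dist_eq_norm]
  refine lt_of_le_of_lt (lp.norm_le_of_forall_le (half_pos hε).le fun k => ?_) (half_lt_self hε)
  rw [lp.coeFn_sub, Pi.sub_apply, EllInfty.sum_smul_unit_apply]
  split_ifs with hk
  · simpa using (half_pos hε).le
  · have hk' : N ≤ k := not_lt.1 fun h => hk (hF (Finset.mem_range.2 h))
    have := hN k hk'
    rw [dist_zero_right] at this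
    simpa using this.le

/-! ### Functionals vanishing on `c_0` -/

/-- Zeroing finitely many coordinates changes the vector by an element of c_0, which the functional
does not see. -/
theorem norm_apply_le_of_eventually {φ : StrongDual 𝕜 (EllInfty 𝕜)}
    (hφ : ∀ x ∈ cZero 𝕜, φ x = 0) {y : EllInfty 𝕜} {C : ℝ} (hC : 0 ≤ C)
    (hy : ∀ᶠ n in atTop, ‖y n‖ ≤ C) : ‖φ y‖ ≤ ‖φ‖ * C := by
  obtain ⟨N, hN⟩ := eventually_atTop.1 hy
  have hz : ∀ n, ‖(if N ≤ n then y n else 0)‖ ≤ C := by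
    intro n
    split_ifs with h
    · exact hN n h
    · simpa using hC
  set z : EllInfty 𝕜 := EllInfty.ofBound _ C hz with hzdef
  have hyz : y - z ∈ cZero 𝕜 := by
    refine tendsto_const_nhds.congr' ?_
    filter_upwards [eventually_ge_atTop N] with n hn
    simp [hzdef, hn]
  have h0 := hφ _ hyz
  rw [map_sub, sub_eq_zero] at h0
  rw [h0]
  refine (φ.le_opNorm z).trans ?_
  gcongr
  exact lp.norm_le_of_forall_le hC hz

/-- The codes of the finite initial segments of `t`; the ranges of these sequences form an almost
disjoint family. -/
def initialSegmentCode (t : ℕ → Bool) (n : ℕ) : ℕ := Encodable.encode ((List.range n).map t)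

theorem initialSegmentCode_eq_iff {s t : ℕ → Bool} {m n : ℕ} :
    initialSegmentCode s m = initialSegmentCode t n ↔ m = n ∧ ∀ k < n, s k = t k := by
  rw [initialSegmentCode, initialSegmentCode, Encodable.encode_inj]
  constructor
  · intro h
    have hl := congrArg List.length h
    simp only [List.length_map, List.length_range] at hl
    subst hl
    refine ⟨rfl, fun k hk => ?_⟩
    exact List.map_inj_left.1 h k (List.mem_range.2 hk)
  · rintro ⟨rfl, h⟩
    exact List.map_inj_left.2 fun k hk => h k (List.mem_range.1 hk)

theorem initialSegmentCode_injective (t : ℕ → Bool) : Function.Injective (initialSegmentCode t) :=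
  fun _ _ h => (initialSegmentCode_eq_iff.1 h).1

/-- Sequences that differ at `k` share only initial segments of length at most `k`. -/
theorem finite_range_inter_range {s t : ℕ → Bool} (hst : s ≠ t) :
    (Set.range (initialSegmentCode s) ∩ Set.range (initialSegmentCode t)).Finite := by
  obtain ⟨k, hk⟩ := Function.ne_iff.1 hst
  refine ((Set.finite_Iic k).image (initialSegmentCode s)).subset ?_
  rintro _ ⟨⟨m, rfl⟩, ⟨n, hn⟩⟩
  refine ⟨m, ?_, rfl⟩
  by_contra hm
  obtain ⟨rfl, h⟩ := initialSegmentCode_eq_iff.1 hn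
  exact hk (h k (not_le.1 hm)).symm

open Classical in
/-- The indicator sequence of a set of natural numbers. -/
noncomputable def EllInfty.indicator (𝕜 : Type*) [RCLike 𝕜] (A : Set ℕ) : EllInfty 𝕜 :=
  EllInfty.ofBound (fun n => if n ∈ A then 1 else 0) 1 (by intro n; split_ifs <;> simp)

theorem EllInfty.indicator_of_mem {A : Set ℕ} {n : ℕ} (h : n ∈ A) :
    EllInfty.indicator 𝕜 A n = 1 := by
  simp [EllInfty.indicator, h]

theorem EllInfty.indicator_of_notMem {A : Set ℕ} {n : ℕ} (h : n ∉ A) :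
    EllInfty.indicator 𝕜 A n = 0 := by
  simp [EllInfty.indicator, h]

theorem EllInfty.indicator_range_notMem_cZero (t : ℕ → Bool) :
    EllInfty.indicator 𝕜 (Set.range (initialSegmentCode t)) ∉ cZero 𝕜 := by
  intro h
  have h1 := (mem_cZero_iff.1 h).comp (initialSegmentCode_injective t).nat_tendsto_atTop
  have h2 : Tendsto (fun _ : ℕ => (1 : 𝕜)) atTop (𝓝 0) :=
    h1.congr fun n => EllInfty.indicator_of_mem (Set.mem_range_self n)
  exact one_ne_zero (tendsto_nhds_unique tendsto_const_nhds h2)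

theorem eventually_norm_sum_smul_indicator_le {ι : Type*} (A : ι → Set ℕ)
    (hA : ∀ i j, i ≠ j → (A i ∩ A j).Finite) (F : Finset ι) (c : ι → 𝕜) (hc : ∀ i, ‖c i‖ ≤ 1) :
    ∀ᶠ n in atTop, ‖(∑ i ∈ F, c i • EllInfty.indicator 𝕜 (A i)) n‖ ≤ 1 := by
  have h : ∀ᶠ n in atTop, ∀ i ∈ F, ∀ j ∈ F, i ≠ j → n ∉ A i ∩ A j := by
    rw [Filter.eventually_all_finset]
    intro i _
    rw [Filter.eventually_all_finset]
    intro j _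
    by_cases hij : i = j
    · simp [hij]
    · filter_upwards [Nat.cofinite_eq_atTop ▸ (hA i j hij).compl_mem_cofinite] with n hn _
      exact hn
  filter_upwards [h] with n hn
  rw [lp.coeFn_sum, Finset.sum_apply]
  by_cases hi : ∃ i ∈ F, n ∈ A i
  · obtain ⟨i, hiF, hi⟩ := hi
    rw [Finset.sum_eq_single_of_mem i hiF]
    · simpa [EllInfty.indicator_of_mem hi] using hc i
    · intro j hj hji
      have : n ∉ A j := fun hnj => hn j hj i hiF hji ⟨hnj, hi⟩
      simp [EllInfty.indicator_of_notMem this]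
  · push Not at hi
    rw [Finset.sum_eq_zero]
    · simp
    · intro i hiF
      simp [EllInfty.indicator_of_notMem (hi i hiF)]

/-- Finite combinations with coefficients in the unit ball have norm at most 1 modulo c_0, so the
values are absolutely summable. -/
theorem countable_support_of_almost_disjoint {ι : Type*} (A : ι → Set ℕ)
    (hA : ∀ i j, i ≠ j → (A i ∩ A j).Finite) {φ : StrongDual 𝕜 (EllInfty 𝕜)}
    (hφ : ∀ x ∈ cZero 𝕜, φ x = 0) : {i | φ (EllInfty.indicator 𝕜 (A i)) ≠ 0}.Countable := by
  have hs : Summable fun i => ‖φ (EllInfty.indicator 𝕜 (A i))‖ := by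
    refine summable_of_sum_le (c := ‖φ‖ * 1) (fun _ => norm_nonneg _) fun F => ?_
    refine sum_norm_apply_le (φ : EllInfty 𝕜 →ₗ[𝕜] 𝕜) _ F _ fun c hc => ?_
    exact norm_apply_le_of_eventually hφ zero_le_one
      (eventually_norm_sum_smul_indicator_le A hA F c hc)
  refine hs.countable_support.mono fun i hi => ?_
  simpa using hi

/-- Countably many functionals on `l_∞` that vanish on `c_0` have a common zero outside `c_0`. -/
theorem exists_notMem_cZero_forall_apply_eq_zero (φ : ℕ → StrongDual 𝕜 (EllInfty 𝕜))
    (hφ : ∀ i, ∀ x ∈ cZero 𝕜, φ i x = 0) : ∃ y, y ∉ cZero 𝕜 ∧ ∀ i, φ i y = 0 := by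
  have hc : (⋃ i, {t : ℕ → Bool |
      φ i (EllInfty.indicator 𝕜 (Set.range (initialSegmentCode t))) ≠ 0}).Countable :=
    Set.countable_iUnion fun i =>
      countable_support_of_almost_disjoint _ (fun _ _ h => finite_range_inter_range h) (hφ i)
  have hne : ∃ t, t ∉ ⋃ i, {t : ℕ → Bool |
      φ i (EllInfty.indicator 𝕜 (Set.range (initialSegmentCode t))) ≠ 0} := by
    by_contra! h
    have hu : (Set.univ : Set (ℕ → Bool)).Countable := hc.mono fun t _ => h t
    rw [Set.countable_univ_iff] at hu
    obtain ⟨g, hg⟩ := exists_injective_nat (ℕ → Bool)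
    refine Function.cantor_injective
      (fun A : Set ℕ => g (fun n => Equiv.propEquivBool (n ∈ A))) fun A B hAB => ?_
    ext n
    exact (Equiv.propEquivBool.injective (congrFun (hg hAB) n)).to_iff
  obtain ⟨t, ht⟩ := hne
  simp only [Set.mem_iUnion, Set.mem_ofPred_eq, not_exists, not_not] at ht
  exact ⟨_, EllInfty.indicator_range_notMem_cZero t, ht⟩

/-! ### Operators on `l_∞` given by coordinatewise summation -/

theorem summable_mul_of_sum_norm_le {u : ℕ → 𝕜} {C : ℝ} (hu : ∀ F : Finset ℕ, ∑ m ∈ F, ‖u m‖ ≤ C)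
    (a : EllInfty 𝕜) : Summable fun m => a m * u m := by
  refine Summable.of_norm_bounded (g := fun m => ‖a‖ * ‖u m‖)
    ((summable_of_sum_le (fun _ => norm_nonneg _) hu).mul_left _) fun m => ?_
  rw [norm_mul]
  gcongr
  exact EllInfty.norm_apply_le a m

theorem norm_sum_mul_le {u : ℕ → 𝕜} {C : ℝ} {F : Finset ℕ} (hu : ∑ m ∈ F, ‖u m‖ ≤ C)
    (a : EllInfty 𝕜) : ‖∑ m ∈ F, a m * u m‖ ≤ C * ‖a‖ := by
  calc ‖∑ m ∈ F, a m * u m‖ ≤ ∑ m ∈ F, ‖a‖ * ‖u m‖ := norm_sum_le_of_le _ fun m _ => by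
        rw [norm_mul]
        gcongr
        exact EllInfty.norm_apply_le a m
    _ ≤ C * ‖a‖ := by
        rw [← Finset.mul_sum, mul_comm]
        gcongr

theorem norm_tsum_mul_le {u : ℕ → 𝕜} {C : ℝ} (hu : ∀ F : Finset ℕ, ∑ m ∈ F, ‖u m‖ ≤ C)
    (a : EllInfty 𝕜) : ‖∑' m, a m * u m‖ ≤ C * ‖a‖ :=
  le_of_tendsto (summable_mul_of_sum_norm_le hu a).hasSum.norm
    (Eventually.of_forall fun F => norm_sum_mul_le (hu F) a)

theorem norm_tsum_mul_sub_le {u : ℕ → 𝕜} {C ε : ℝ} (hu : ∀ F : Finset ℕ, ∑ m ∈ F, ‖u m‖ ≤ C)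
    (n : ℕ) (hn : ∀ F : Finset ℕ, n ∉ F → ∑ m ∈ F, ‖u m‖ ≤ ε)
    (a : EllInfty 𝕜) : ‖(∑' m, a m * u m) - a n * u n‖ ≤ ε * ‖a‖ := by
  refine le_of_tendsto ((summable_mul_of_sum_norm_le hu a).hasSum.sub_const (a n * u n)).norm ?_
  filter_upwards [eventually_ge_atTop {n}] with F hF
  have hnF : n ∈ F := hF (Finset.mem_singleton_self n)
  rw [← Finset.sum_erase_add F _ hnF, add_sub_cancel_right]
  exact norm_sum_mul_le (hn _ (Finset.notMem_erase n F)) a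

/-- The weak-star continuous operator on `l_∞` that maps the unit vectors to the given vectors. -/
noncomputable def sumOperator (w : ℕ → EllInfty 𝕜) (C : ℝ)
    (hw : ∀ k (F : Finset ℕ), ∑ m ∈ F, ‖w m k‖ ≤ C) : EllInfty 𝕜 →L[𝕜] EllInfty 𝕜 :=
  LinearMap.mkContinuous
    { toFun := fun a => EllInfty.ofBound (fun k => ∑' m, a m * w m k) (C * ‖a‖)
        fun k => norm_tsum_mul_le (hw k) a
      map_add' := fun a b => by
        ext k
        simp only [EllInfty.ofBound_apply, lp.coeFn_add, Pi.add_apply, add_mul]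
        exact (summable_mul_of_sum_norm_le (hw k) a).tsum_add
          (summable_mul_of_sum_norm_le (hw k) b)
      map_smul' := fun c a => by
        ext k
        simp only [EllInfty.ofBound_apply, lp.coeFn_smul, Pi.smul_apply, smul_eq_mul, mul_assoc,
          RingHom.id_apply]
        exact tsum_mul_left } C fun a =>
      lp.norm_le_of_forall_le
        (mul_nonneg (by simpa using hw 0 ∅) (norm_nonneg a)) fun k => norm_tsum_mul_le (hw k) a

theorem sumOperator_apply (w : ℕ → EllInfty 𝕜) (C : ℝ)
    (hw : ∀ k (F : Finset ℕ), ∑ m ∈ F, ‖w m k‖ ≤ C) (a : EllInfty 𝕜) (k : ℕ) :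
    sumOperator w C hw a k = ∑' m, a m * w m k := rfl

theorem sumOperator_unit (w : ℕ → EllInfty 𝕜) (C : ℝ)
    (hw : ∀ k (F : Finset ℕ), ∑ m ∈ F, ‖w m k‖ ≤ C) (n : ℕ) :
    sumOperator w C hw (EllInfty.unit 𝕜 n) = w n := by
  ext k
  simp [sumOperator_apply, EllInfty.unit_apply]

/-- For `a` in c_0 the unit vector expansion converges in norm, so the image is a norm limit of
combinations of the `w m`. -/
theorem sumOperator_mem (w : ℕ → EllInfty 𝕜) (C : ℝ)
    (hw : ∀ k (F : Finset ℕ), ∑ m ∈ F, ‖w m k‖ ≤ C) {M : Submodule 𝕜 (EllInfty 𝕜)}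
    (hM : IsClosed (M : Set (EllInfty 𝕜))) (hwM : ∀ m, w m ∈ M) {a : EllInfty 𝕜}
    (ha : a ∈ cZero 𝕜) : sumOperator w C hw a ∈ M := by
  have h := (hasSum_smul_unit ha).mapL (sumOperator w C hw)
  refine hM.mem_of_tendsto h (Eventually.of_forall fun F => M.sum_mem fun m _ => ?_)
  rw [map_smul, sumOperator_unit]
  exact M.smul_mem _ (hwM m)

/-- At coordinate `κ n` the diagonal term dominates: `d * ‖a n‖` is at most the norm of the image
plus `d / 2 * ‖a‖`. Taking the supremum over `n` absorbs the last term. -/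
theorem norm_le_of_offDiag (w : ℕ → EllInfty 𝕜) (C : ℝ)
    (hw : ∀ k (F : Finset ℕ), ∑ m ∈ F, ‖w m k‖ ≤ C) {d : ℝ} (hd : 0 < d) (κ : ℕ → ℕ)
    (hκ : ∀ n, d ≤ ‖w n (κ n)‖)
    (hoff : ∀ n (F : Finset ℕ), n ∉ F → ∑ m ∈ F, ‖w m (κ n)‖ ≤ d / 2) (a : EllInfty 𝕜) :
    ‖a‖ ≤ (2 / d) * ‖sumOperator w C hw a‖ := by
  have h : ∀ n, ‖a n‖ ≤ (‖sumOperator w C hw a‖ + d / 2 * ‖a‖) / d := by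
    intro n
    rw [le_div_iff₀ hd]
    have h1 := norm_tsum_mul_sub_le (hw (κ n)) n (hoff n) a
    have h2 := EllInfty.norm_apply_le (sumOperator w C hw a) (κ n)
    rw [sumOperator_apply] at h2
    have h3 := norm_sub_norm_le (a n * w n (κ n)) (∑' m, a m * w m (κ n))
    rw [norm_sub_rev, norm_mul] at h3
    have h4 := mul_le_mul_of_nonneg_left (hκ n) (norm_nonneg (a n))
    linarith
  have h5 := lp.norm_le_of_forall_le (by positivity) h
  rw [le_div_iff₀ hd] at h5
  rw [div_mul_eq_mul_div, le_div_iff₀ hd]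
  linarith

/-! ### From embeddings of c_0 to embeddings of l_∞ -/

theorem sum_norm_apply_unit_le (J : cZero 𝕜 →L[𝕜] EllInfty 𝕜) (k : ℕ) (F : Finset ℕ) :
    ∑ m ∈ F, ‖J ⟨EllInfty.unit 𝕜 m, EllInfty.unit_mem_cZero m⟩ k‖ ≤ ‖J‖ := by
  refine sum_norm_apply_le ((lp.evalCLM 𝕜 (fun _ : ℕ => 𝕜) ⊤ k ∘L J : cZero 𝕜 →L[𝕜] 𝕜) :
    cZero 𝕜 →ₗ[𝕜] 𝕜) (fun m => ⟨EllInfty.unit 𝕜 m, EllInfty.unit_mem_cZero m⟩) F _ fun c hc => ?_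
  refine (EllInfty.norm_apply_le (J _) k).trans ((J.le_opNorm_of_le ?_).trans_eq (mul_one _))
  rw [← Submodule.norm_coe]
  simpa using EllInfty.norm_sum_smul_unit_le F c hc

/-- An isomorphic embedding of `c_0` into `l_∞` with image in a closed subspace `M` yields an
isomorphic embedding of `l_∞` into itself that maps `c_0` into `M`. -/
theorem exists_antilipschitz_of_cZero {M : Submodule 𝕜 (EllInfty 𝕜)}
    (hM : IsClosed (M : Set (EllInfty 𝕜))) (J : cZero 𝕜 →L[𝕜] EllInfty 𝕜) (hJM : ∀ x, J x ∈ M)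
    {c : NNReal} (hJ : AntilipschitzWith c J) :
    ∃ (T : EllInfty 𝕜 →L[𝕜] EllInfty 𝕜) (K : NNReal), AntilipschitzWith K T ∧
      ∀ a ∈ cZero 𝕜, T a ∈ M := by
  obtain ⟨v, hvn, hC⟩ : ∃ v : ℕ → cZero 𝕜, (∀ m, ‖v m‖ = 1) ∧
      ∀ k (F : Finset ℕ), ∑ m ∈ F, ‖J (v m) k‖ ≤ ‖J‖ :=
    ⟨fun m => ⟨EllInfty.unit 𝕜 m, EllInfty.unit_mem_cZero m⟩, EllInfty.norm_unit,
      sum_norm_apply_unit_le J⟩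
  obtain ⟨d, hd, hdv⟩ : ∃ d : ℝ, 0 < d ∧ ∀ m, d < ‖J (v m)‖ := by
    -- Adding 1 covers `c = 0` and makes the bound strict; strictness is what gives a coordinate of
    -- modulus at least `d`.
    refine ⟨1 / (c + 1), by positivity, fun m => ?_⟩
    rw [div_lt_iff₀ (by positivity)]
    have h1 := hJ.le_mul_norm J.map_zero (v m)
    rw [hvn] at h1
    have h4 : 0 < ‖J (v m)‖ := by
      refine (norm_nonneg _).lt_of_ne fun h => ?_
      rw [← h, mul_zero] at h1
      exact absurd h1 (by norm_num)
    linarith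
  have hk : ∀ m, ∃ k, d ≤ ‖J (v m) k‖ := by
    intro m
    by_contra! h
    exact (hdv m).not_ge (lp.norm_le_of_forall_le hd.le fun k => (h k).le)
  choose κ hκ using hk
  obtain ⟨K, hK⟩ := exists_nat_ge (‖J‖ / (d / 2))
  obtain ⟨f, hinj, hf⟩ := exists_injective_offDiag_sum_le (half_pos hd).le K
    (fun n m => ‖J (v m) (κ n)‖)
    fun n F => (hC (κ n) F).trans ((div_le_iff₀ (half_pos hd)).1 hK)
  have hw : ∀ k (F : Finset ℕ), ∑ m ∈ F, ‖J (v (f m)) k‖ ≤ ‖J‖ := by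
    intro k F
    have := hC k (F.image f)
    rwa [Finset.sum_image hinj.injOn] at this
  refine ⟨sumOperator (fun m => J (v (f m))) ‖J‖ hw, ⟨2 / d, by positivity⟩, ?_, fun a ha =>
    sumOperator_mem _ _ _ hM (fun m => hJM (v (f m))) ha⟩
  exact ContinuousLinearMap.antilipschitz_of_bound _ fun a =>
    norm_le_of_offDiag _ _ hw hd (fun n => κ (f n)) (fun n => hκ (f n)) hf a

theorem hasNIP_quotient_submoduleOf {E : Type*} [NormedAddCommGroup E] [NormedSpace 𝕜 E]
    (N H : Submodule 𝕜 E) (T : EllInfty 𝕜 ≃L[𝕜] H)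
    (hT : ∀ x, (T x : E) ∈ N ↔ x ∈ cZero 𝕜) : HasNIP 𝕜 (H ⧸ N.submoduleOf H) := by
  intro φ hφ
  obtain ⟨y, hy, hφy⟩ := exists_notMem_cZero_forall_apply_eq_zero
    (fun i => φ i ∘L (N.submoduleOf H).mkQL ∘L (T : EllInfty 𝕜 →L[𝕜] H)) (by
      intro i x hx
      have h0 : (N.submoduleOf H).mkQ (T x) = 0 :=
        (Submodule.Quotient.mk_eq_zero _).2 ((hT x).2 hx)
      exact (congrArg (φ i) h0).trans (φ i).map_zero)
  have hmem : (N.submoduleOf H).mkQ (T y) ∈ ⋂ i, {x | φ i x = 0} := Set.mem_iInter.2 hφy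
  rw [hφ, Set.mem_singleton_iff, Submodule.mkQ_apply, Submodule.Quotient.mk_eq_zero] at hmem
  exact hy ((hT y).1 hmem)

end

/-! ### Closedness of ranges and the main theorem -/

/-- A subspace isomorphic to a complete space is closed. -/
theorem isClosed_of_continuousLinearEquiv {𝕜 E F : Type*} [NontriviallyNormedField 𝕜]
    [NormedAddCommGroup E] [NormedSpace 𝕜 E] [NormedAddCommGroup F] [NormedSpace 𝕜 F]
    [CompleteSpace F] {M : Submodule 𝕜 E} (e : M ≃L[𝕜] F) : IsClosed (M : Set E) := by
  have : CompleteSpace M :=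
    (completeSpace_congr (e := e.toEquiv) e.isUniformEmbedding).2 inferInstance
  exact (completeSpace_coe_iff_isComplete.1 this).isClosed

theorem antilipschitz_subtypeL_comp_symm {𝕜 E F : Type*} [NontriviallyNormedField 𝕜]
    [NormedAddCommGroup E] [NormedSpace 𝕜 E] [NormedAddCommGroup F] [NormedSpace 𝕜 F]
    {M : Submodule 𝕜 E} (e : M ≃L[𝕜] F) :
    AntilipschitzWith ‖(e : M →L[𝕜] F)‖₊ (M.subtypeL ∘L (e.symm : F →L[𝕜] M)) :=
  e.symm.antilipschitz

theorem theorem18 (𝕜 : Type*) [RCLike 𝕜] (M : Submodule 𝕜 (EllInfty 𝕜))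
    (hM : Nonempty (M ≃L[𝕜] cZero 𝕜)) :
    ∃ N H : Submodule 𝕜 (EllInfty 𝕜),
      IsClosed (N : Set (EllInfty 𝕜)) ∧ IsClosed (H : Set (EllInfty 𝕜)) ∧
      N ≤ M ∧ N ≤ H ∧
      (∃ T : EllInfty 𝕜 ≃L[𝕜] H, ∃ S : cZero 𝕜 ≃L[𝕜] N,
        ∀ x : cZero 𝕜, (S x : EllInfty 𝕜) = (T (x : EllInfty 𝕜) : EllInfty 𝕜)) ∧
      HasNIP 𝕜 (H ⧸ N.submoduleOf H) := by
  obtain ⟨e⟩ := hM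
  obtain ⟨T, K, hT, hTM⟩ := exists_antilipschitz_of_cZero (isClosed_of_continuousLinearEquiv e) _
    (fun x => (e.symm x).2) (antilipschitz_subtypeL_comp_symm e)
  have hR : AntilipschitzWith K (T ∘L (cZero 𝕜).subtypeL) := fun x y => hT x y
  have hTc := (hT.isClosedEmbedding T.uniformContinuous).isClosed_range
  have hRc := (hR.isClosedEmbedding (T ∘L (cZero 𝕜).subtypeL).uniformContinuous).isClosed_range
  refine ⟨(T ∘L (cZero 𝕜).subtypeL).range, T.range, hRc, hTc, ?_, ?_,
    ⟨T.equivRange hT.injective hTc, ContinuousLinearMap.equivRange hR.injective hRc,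
      fun x => rfl⟩, hasNIP_quotient_submoduleOf _ _ (T.equivRange hT.injective hTc) fun x => ?_⟩
  · rintro _ ⟨x, rfl⟩
    exact hTM x x.2
  · rintro _ ⟨x, rfl⟩
    exact ⟨x, rfl⟩
  · constructor
    · rintro ⟨y, hy⟩
      have hyx : (y : EllInfty 𝕜) = x := hT.injective hy
      exact hyx ▸ y.2
    · exact fun hx => ⟨⟨x, hx⟩, rfl⟩
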